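/- Let $k\ge 0$ and let $M=\{M_\gamma\}_{\gamma\in\Gamma}$ be a defining family of functions on $\mathbb C^k$, i.e. a family of nonnegative (Lebesgue) measurable functions $M_\gamma$ on $\mathbb C^k$, bounded on every bounded subset of $\mathbb C^k$, such that (a) for all $\gamma_1,\gamma_2\in\Gamma$ there are $\gamma\in\Gamma$ and $C>0$ with $M_\gamma\ge C(M_{\gamma_1}+M_{\gamma_2})$; (b) there is a countable set $\Gamma'\subset\Gamma$ such that for every $\gamma\in\Gamma$ there are $\gamma'\in\Gamma'$ and $C>0$ with $CM_\gamma\le M_{\gamma'}$; (c) for every $z\in\mathbb C^k$ there are $\gamma\in\Gamma$, a neighborhood $O(z)$ of $z$ and $C>0$ with $M_\gamma(z')\ge C$ for all $z'\in O(z)$. Suppose that $M$ satisfies the following two conditions: (I) for every $\gamma\in\Gamma$ there are $\gamma'\in\Gamma$ and a nonnegative Lebesgue-integrable function $L$ on $\mathbb C^k$ such that $M_\gamma\le L\,M_{\gamma'}$ on $\mathbb C^k$ and $L(z)\to 0$ as $|z|\to\infty$; (II) for every $\gamma\in\Gamma$ there are $\gamma'\in\Gamma$, a neighborhood $B$ of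 the origin in $\mathbb C^k$ and $C>0$ such that $M_\gamma(z)\le C M_{\gamma'}(z+w)$ for all $z\in\mathbb C^k$ and $w\in B$. Let $\mathcal H(M)$ be the space of all entire functions $f$ on $\mathbb C^k$ such that $\|f\|_\gamma=\sup_{z\in\mathbb C^k}M_\gamma(z)|f(z)|<\infty$ for all $\gamma\in\Gamma$, with the topology determined by these seminorms. For real $p\ge 1$ let $\mathcal H_p(M)$ be the space of all entire functions $f$ on $\mathbb C^k$ such that $\|f\|^p_\gamma=\bigl(\int_{\mathbb C^k}M_\gamma(z)^p|f(z)|^p\,d\lambda(z)\bigr)^{1/p}<\infty$ for all $\gamma\in\Gamma$ (where $\lambda$ is Lebesgue measure), with the topology determined by these seminorms. Then the locally convex space $\mathcal H(M)$ is nuclear and, for every real $p\ge 1$, it coincides with $\mathcal H_p(M)$ both as a set and topologically. -/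

import Mathlib

open MeasureTheory Filter Topology
open scoped ENNReal

noncomputable section

/-! ### Nuclear locally convex spaces -/

section Nuclear

variable {𝕜 E F : Type*} [RCLike 𝕜] [AddCommGroup E] [Module 𝕜 E]

/-- A copy of the vector space `E`, with the seminormed structure given by the seminorm `p`. -/
def SeminormedCopy (_p : Seminorm 𝕜 E) : Type _ := E

instance (p : Seminorm 𝕜 E) : SeminormedAddCommGroup (SeminormedCopy p) :=
  AddGroupSeminorm.toSeminormedAddCommGroup (E := E) p.toAddGroupSeminorm

instance (p : Seminorm 𝕜 E) : Module 𝕜 (SeminormedCopy p) :=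
  inferInstanceAs (Module 𝕜 E)

instance (p : Seminorm 𝕜 E) : NormedSpace 𝕜 (SeminormedCopy p) where
  norm_smul_le a x := le_of_eq (map_smul_eq_mul p a x)

/-- The local Banach space of the seminorm `p`: the Hausdorff completion of `(E, p)`, that is, the
completion of the normed space `E / {x | p x = 0}`. -/
abbrev LocalBanach (p : Seminorm 𝕜 E) : Type _ :=
  UniformSpace.Completion (SeminormedCopy p)

/-- The canonical linear map from `E` to the local Banach space of the seminorm `p`. -/
def toLocalBanach (p : Seminorm 𝕜 E) : E →ₗ[𝕜] LocalBanach p :=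
  (UniformSpace.Completion.toComplL (𝕜 := 𝕜) (E := SeminormedCopy p)).toLinearMap

/-- Nuclear linear maps from a topological vector space `E` to a Banach space `F`: those of the form
`T x = ∑ n, c n • φ n x • y n` with `∑ n, ‖c n‖ < ∞`, an equicontinuous sequence `φ` of continuous
linear functionals, and a bounded sequence `y`. -/
def IsNuclearMap [TopologicalSpace E] [NormedAddCommGroup F] [NormedSpace 𝕜 F] [CompleteSpace F]
    (T : E →ₗ[𝕜] F) : Prop :=
  ∃ (c : ℕ → 𝕜) (φ : ℕ → E →L[𝕜] 𝕜) (y : ℕ → F),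
    Summable (fun n => ‖c n‖) ∧
    Equicontinuous (fun n => (φ n : E → 𝕜)) ∧
    Bornology.IsBounded (Set.range y) ∧
    ∀ x : E, HasSum (fun n => c n • φ n x • y n) (T x)

variable (𝕜 E) in
/-- Nuclear spaces: Hausdorff locally convex spaces such that, for every continuous seminorm `p`,
the canonical map to the local Banach space of `p` is nuclear. (`PolynormableSpace` says that the
topology is given by a family of `𝕜`-seminorms.) -/
structure IsNuclearSpace [TopologicalSpace E] : Prop where
  t2Space : T2Space E
  polynormableSpace : PolynormableSpace 𝕜 E
  isNuclearMap_toLocalBanach :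
    ∀ p : Seminorm 𝕜 E, Continuous p → IsNuclearMap (toLocalBanach p)

end Nuclear

/-! ### Defining families of functions -/

/-- Defining families of functions on `ℂ^k`. Measurability is Lebesgue measurability, which for a
real function is almost everywhere measurability with respect to Lebesgue measure. -/
structure DefiningFamily (Γ : Type*) (k : ℕ) where
  /-- the functions of the family -/
  toFun : Γ → (Fin k → ℂ) → ℝ
  nonneg : ∀ γ z, 0 ≤ toFun γ z
  aemeasurable : ∀ γ, AEMeasurable (toFun γ) volume
  bddAbove_of_isBounded : ∀ γ (B : Set (Fin k → ℂ)), Bornology.IsBounded B →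
    BddAbove (toFun γ '' B)
  directed : ∀ γ₁ γ₂, ∃ γ, ∃ C : ℝ, 0 < C ∧ ∀ z, C * (toFun γ₁ z + toFun γ₂ z) ≤ toFun γ z
  countable_cofinal : ∃ Γ' : Set Γ, Γ'.Countable ∧
    ∀ γ, ∃ γ' ∈ Γ', ∃ C : ℝ, 0 < C ∧ ∀ z, C * toFun γ z ≤ toFun γ' z
  locally_pos : ∀ z, ∃ γ, ∃ U ∈ 𝓝 z, ∃ C : ℝ, 0 < C ∧ ∀ z' ∈ U, C ≤ toFun γ z'

namespace DefiningFamily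

variable {Γ : Type*} {k : ℕ}

instance : CoeFun (DefiningFamily Γ k) fun _ => Γ → (Fin k → ℂ) → ℝ := ⟨toFun⟩

/-- For every `γ` there are `γ'` and a summable function `L ≥ 0` vanishing at infinity such that
`M_γ ≤ L M_γ'`. -/
def ConditionI (M : DefiningFamily Γ k) : Prop :=
  ∀ γ, ∃ γ', ∃ L : (Fin k → ℂ) → ℝ, (∀ z, 0 ≤ L z) ∧ Integrable L volume ∧
    (∀ z, M γ z ≤ L z * M γ' z) ∧ Tendsto L (Bornology.cobounded (Fin k → ℂ)) (𝓝 0)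

/-- For every `γ` there are `γ'`, a neighborhood `B` of the origin and `C > 0` such that
`M_γ(z) ≤ C M_γ'(z + w)` for all `z` and all `w ∈ B`. -/
def ConditionII (M : DefiningFamily Γ k) : Prop :=
  ∀ γ, ∃ γ', ∃ B ∈ 𝓝 (0 : Fin k → ℂ), ∃ C : ℝ, 0 < C ∧
    ∀ z, ∀ w ∈ B, M γ z ≤ C * M γ' (z + w)

variable (M : DefiningFamily Γ k)

/-! ### The space `H(M)` -/

/-- The entire functions `f` on `ℂ^k` with `sup_z M_γ(z) |f(z)| < ∞` for all `γ`. -/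
def HSubmodule : Submodule ℂ ((Fin k → ℂ) → ℂ) where
  carrier := {f | Differentiable ℂ f ∧ ∀ γ, BddAbove (Set.range fun z => M γ z * ‖f z‖)}
  zero_mem' := ⟨differentiable_const 0, fun γ => ⟨0, by rintro _ ⟨z, rfl⟩; simp⟩⟩
  add_mem' := by
    rintro f g ⟨hf, hf'⟩ ⟨hg, hg'⟩
    refine ⟨hf.add hg, fun γ => ?_⟩
    obtain ⟨A, hA⟩ := hf' γ
    obtain ⟨B, hB⟩ := hg' γ
    refine ⟨A + B, ?_⟩
    rintro _ ⟨z, rfl⟩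
    have h1 : M γ z * ‖f z‖ ≤ A := hA ⟨z, rfl⟩
    have h2 : M γ z * ‖g z‖ ≤ B := hB ⟨z, rfl⟩
    have h3 := mul_le_mul_of_nonneg_left (norm_add_le (f z) (g z)) (M.nonneg γ z)
    simp only [Pi.add_apply]
    linarith
  smul_mem' := by
    rintro c f ⟨hf, hf'⟩
    refine ⟨hf.const_smul c, fun γ => ?_⟩
    obtain ⟨A, hA⟩ := hf' γ
    refine ⟨‖c‖ * A, ?_⟩
    rintro _ ⟨z, rfl⟩
    have h1 : M γ z * ‖f z‖ ≤ A := hA ⟨z, rfl⟩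
    have h2 := mul_le_mul_of_nonneg_left h1 (norm_nonneg c)
    simp only [Pi.smul_apply, smul_eq_mul, norm_mul]
    linarith

/-- The space `H(M)`. (A type of its own, so that it does not inherit the topology of pointwise
convergence.) -/
def H : Type := M.HSubmodule

instance : AddCommGroup M.H := inferInstanceAs (AddCommGroup M.HSubmodule)

instance : Module ℂ M.H := inferInstanceAs (Module ℂ M.HSubmodule)

instance : FunLike M.H (Fin k → ℂ) ℂ where
  coe f := M.HSubmodule.subtype f
  coe_injective _ _ h := Subtype.ext h

variable {M} in
theorem H.differentiable (f : M.H) : Differentiable ℂ f := f.2.1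

variable {M} in
theorem H.bddAbove (f : M.H) (γ : Γ) : BddAbove (Set.range fun z => M γ z * ‖f z‖) := f.2.2 γ

variable {M} in
theorem H.add_apply (f g : M.H) (z : Fin k → ℂ) : (f + g) z = f z + g z := rfl

variable {M} in
theorem H.smul_apply (c : ℂ) (f : M.H) (z : Fin k → ℂ) : (c • f) z = c * f z := rfl

/-- The seminorms `‖f‖_γ = sup_z M_γ(z) |f(z)|` on `H(M)`. -/
def HSeminorm : SeminormFamily ℂ M.H Γ := fun γ =>
  Seminorm.of (fun f => ⨆ z, M γ z * ‖f z‖)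
    (fun f g => by
      refine ciSup_le fun z => ?_
      have h1 := le_ciSup (f.bddAbove γ) z
      have h2 := le_ciSup (g.bddAbove γ) z
      have h3 := mul_le_mul_of_nonneg_left (norm_add_le (f z) (g z)) (M.nonneg γ z)
      rw [H.add_apply]
      linarith)
    (fun c f => by
      rw [Real.mul_iSup_of_nonneg (norm_nonneg c)]
      refine congrArg _ (funext fun z => ?_)
      rw [H.smul_apply, norm_mul]
      ring)

theorem HSeminorm_apply (γ : Γ) (f : M.H) : M.HSeminorm γ f = ⨆ z, M γ z * ‖f z‖ := rfl

/-- The topology of `H(M)` is determined by the seminorms `‖·‖_γ`. -/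
instance : TopologicalSpace M.H := M.HSeminorm.moduleFilterBasis.topology

/-! ### The spaces `H_p(M)` -/

variable {M} in
theorem integrable_rpow_iff {f : (Fin k → ℂ) → ℂ} (hf : Continuous f) (γ : Γ) {p : ℝ} (hp : 1 ≤ p) :
    Integrable (fun z => M γ z ^ p * ‖f z‖ ^ p) volume ↔
      MemLp (fun z => (M γ z : ℂ) * f z) (ENNReal.ofReal p) volume := by
  have hm : AEStronglyMeasurable (fun z => (M γ z : ℂ) * f z) volume :=
    (Complex.measurable_ofReal.comp_aemeasurable (M.aemeasurable γ)).aestronglyMeasurable.mul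
      hf.aestronglyMeasurable
  rw [← integrable_norm_rpow_iff hm (by simp; linarith) ENNReal.ofReal_ne_top,
    ENNReal.toReal_ofReal (by linarith)]
  refine iff_of_eq (congrArg (fun g => Integrable g volume) (funext fun z => ?_))
  rw [norm_mul, Complex.norm_of_nonneg (M.nonneg γ z),
    Real.mul_rpow (M.nonneg γ z) (norm_nonneg _)]

/-- The entire functions `f` on `ℂ^k` with `∫ M_γ(z)^p |f(z)|^p dλ(z) < ∞` for all `γ`. -/
def HpSubmodule (p : ℝ) (hp : 1 ≤ p) : Submodule ℂ ((Fin k → ℂ) → ℂ) where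
  carrier := {f | Differentiable ℂ f ∧
    ∀ γ, Integrable (fun z => M γ z ^ p * ‖f z‖ ^ p) volume}
  zero_mem' := ⟨differentiable_const 0, fun γ => by
    simp [Real.zero_rpow (show p ≠ 0 by linarith)]⟩
  add_mem' := by
    rintro f g ⟨hf, hf'⟩ ⟨hg, hg'⟩
    refine ⟨hf.add hg, fun γ => ?_⟩
    have h := ((integrable_rpow_iff hf.continuous γ hp).1 (hf' γ)).add
      ((integrable_rpow_iff hg.continuous γ hp).1 (hg' γ))
    refine (integrable_rpow_iff (hf.add hg).continuous γ hp).2 ?_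
    convert h using 1
    funext z
    simp [mul_add]
  smul_mem' := by
    rintro c f ⟨hf, hf'⟩
    refine ⟨hf.const_smul c, fun γ => ?_⟩
    have h := ((integrable_rpow_iff hf.continuous γ hp).1 (hf' γ)).const_mul c
    refine (integrable_rpow_iff (hf.const_smul c).continuous γ hp).2 ?_
    convert h using 1
    funext z
    simp [mul_left_comm]

/-- The space `H_p(M)`. -/
def Hp (p : ℝ) (hp : 1 ≤ p) : Type := M.HpSubmodule p hp

variable (p : ℝ) (hp : 1 ≤ p)

instance : AddCommGroup (M.Hp p hp) := inferInstanceAs (AddCommGroup (M.HpSubmodule p hp))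

instance : Module ℂ (M.Hp p hp) := inferInstanceAs (Module ℂ (M.HpSubmodule p hp))

instance : FunLike (M.Hp p hp) (Fin k → ℂ) ℂ where
  coe f := (M.HpSubmodule p hp).subtype f
  coe_injective _ _ h := Subtype.ext h

variable {M p hp} in
theorem Hp.differentiable (f : M.Hp p hp) : Differentiable ℂ f := f.2.1

variable {M p hp} in
theorem Hp.integrable (f : M.Hp p hp) (γ : Γ) :
    Integrable (fun z => M γ z ^ p * ‖f z‖ ^ p) volume := f.2.2 γ

variable {M p hp} in
theorem Hp.memLp (f : M.Hp p hp) (γ : Γ) :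
    MemLp (fun z => (M γ z : ℂ) * f z) (ENNReal.ofReal p) volume :=
  (integrable_rpow_iff f.differentiable.continuous γ hp).1 (f.integrable γ)

variable {M p hp} in
theorem Hp.add_apply (f g : M.Hp p hp) (z : Fin k → ℂ) : (f + g) z = f z + g z := rfl

variable {M p hp} in
theorem Hp.smul_apply (c : ℂ) (f : M.Hp p hp) (z : Fin k → ℂ) : (c • f) z = c * f z := rfl

theorem integral_rpow_eq_eLpNorm (γ : Γ) (f : M.Hp p hp) :
    (∫ z, M γ z ^ p * ‖f z‖ ^ p) ^ (1 / p) =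
      (eLpNorm (fun z => (M γ z : ℂ) * f z) (ENNReal.ofReal p) volume).toReal := by
  have h := f.memLp γ
  have h0 : ∀ z, 0 ≤ M γ z ^ p * ‖f z‖ ^ p := fun z =>
    mul_nonneg (Real.rpow_nonneg (M.nonneg γ z) _) (Real.rpow_nonneg (norm_nonneg _) _)
  rw [h.eLpNorm_eq_integral_rpow_norm (by simp; linarith) ENNReal.ofReal_ne_top,
    ENNReal.toReal_ofReal (show 0 ≤ p by linarith)]
  have e : ∀ z, ‖(M γ z : ℂ) * f z‖ ^ p = M γ z ^ p * ‖f z‖ ^ p := fun z => by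
    rw [norm_mul, Complex.norm_of_nonneg (M.nonneg γ z),
      Real.mul_rpow (M.nonneg γ z) (norm_nonneg _)]
  simp only [e]
  rw [ENNReal.toReal_ofReal (Real.rpow_nonneg (integral_nonneg h0) _), one_div]

/-- The seminorms `‖f‖^p_γ = (∫ M_γ(z)^p |f(z)|^p dλ(z))^(1/p)` on `H_p(M)`. -/
def HpSeminorm : SeminormFamily ℂ (M.Hp p hp) Γ := fun γ =>
  Seminorm.of (fun f => (∫ z, M γ z ^ p * ‖f z‖ ^ p) ^ (1 / p))
    (fun f g => by
      have hf := f.memLp γ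
      have hg := g.memLp γ
      rw [integral_rpow_eq_eLpNorm, integral_rpow_eq_eLpNorm, integral_rpow_eq_eLpNorm,
        ← ENNReal.toReal_add hf.eLpNorm_ne_top hg.eLpNorm_ne_top]
      refine ENNReal.toReal_mono (by simp [hf.eLpNorm_ne_top, hg.eLpNorm_ne_top]) ?_
      have e : (fun z => (M γ z : ℂ) * (f + g : M.Hp p hp) z) =
          (fun z => (M γ z : ℂ) * f z) + fun z => (M γ z : ℂ) * g z := by
        funext z
        simp [Hp.add_apply, mul_add]
      rw [e]
      exact eLpNorm_add_le hf.aestronglyMeasurable hg.aestronglyMeasurable (by simpa using hp))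
    (fun c f => by
      rw [integral_rpow_eq_eLpNorm, integral_rpow_eq_eLpNorm]
      have e : (fun z => (M γ z : ℂ) * (c • f : M.Hp p hp) z) =
          c • fun z => (M γ z : ℂ) * f z := by
        funext z
        simp [Hp.smul_apply, mul_left_comm]
      rw [e, eLpNorm_const_smul, ENNReal.toReal_mul, toReal_enorm])

theorem HpSeminorm_apply (γ : Γ) (f : M.Hp p hp) :
    M.HpSeminorm p hp γ f = (∫ z, M γ z ^ p * ‖f z‖ ^ p) ^ (1 / p) := rfl

/-- The topology of `H_p(M)` is determined by the seminorms `‖·‖^p_γ`. -/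
instance : TopologicalSpace (M.Hp p hp) := (M.HpSeminorm p hp).moduleFilterBasis.topology

end DefiningFamily

end

/-! The weighted sup norms and the weighted `L^p` norms dominate each other after a change of index.
By (I), `M γ * ‖f‖ ≤ L * (M γ' * ‖f‖)`, so the `L^p` norm is at most the `L^p` norm of `L` times a
sup norm; here `L` is first made bounded, so that it lies in every `L^p`. Conversely, the mean value
property and Jensen's inequality bound `‖f z‖ ^ p` by an average over a small ball around `z`, and
(II) moves the weight from `z` to the points of that ball.

For nuclearity take `p = 2`: the topology is given by the Hilbert seminorms `‖hI.toL2 γ f‖`. Point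
evaluations are bounded for them, so for a family `e` orthonormal for a suitable index, `∑ ‖e i z‖ ^
2` times a squared weight is bounded in `z`. Integrating this against `L ^ 2` shows that each
Hilbert seminorm is Hilbert–Schmidt with respect to another one (`exists_isHilbertSchmidtWrt_toL2`).
Two such steps in succession give a nuclear map
(`isNuclearMap_toLocalBanach_of_isHilbertSchmidtWrt`). No Hilbert space completion is formed: every
orthonormal family consists of images of elements of the space itself. -/

/-! ### Orthonormal bases inside the range of a linear map -/

/-- The range of a linear map into a separable Hilbert space has an orthonormal basis that consists
of values of the map. -/
theorem LinearMap.exists_orthonormal_hasSum {𝕜 E X : Type*} [RCLike 𝕜] [AddCommGroup E]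
    [Module 𝕜 E] [NormedAddCommGroup X] [InnerProductSpace 𝕜 X] [CompleteSpace X]
    [SecondCountableTopology X] (A : E →ₗ[𝕜] X) :
    ∃ (ι : Type) (_ : Countable ι) (e : ι → E), Orthonormal 𝕜 (fun i => A (e i)) ∧
      ∀ f, HasSum (fun i => inner 𝕜 (A (e i)) (A f) • A (e i)) (A f) := by
  classical
  let R := LinearMap.range A
  let d : ℕ → R := TopologicalSpace.denseSeq R
  -- Gram–Schmidt uses only finite combinations, so it stays in the range, which need not be closed.
  -- Zero vectors come from linear dependences and are discarded in `ι`.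
  let g : ℕ → R := InnerProductSpace.gramSchmidtNormed 𝕜 d
  let ι := {n // g n ≠ 0}
  have hg : Orthonormal 𝕜 (fun i : ι => g i) :=
    InnerProductSpace.gramSchmidtNormed_orthonormal' d
  choose e he using fun n => (g n).2
  have ho : Orthonormal 𝕜 (fun i : ι => A (e i)) := by
    simp only [he]
    exact hg.comp_linearIsometry R.subtypeₗᵢ
  refine ⟨ι, inferInstance, fun i => e i, ho, fun f => ?_⟩
  let K := Submodule.span 𝕜 (Set.range fun i : ι => A (e i))
  have hgK : ∀ n, (g n : X) ∈ K := fun n => by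
    by_cases h : g n = 0
    · rw [h]; exact K.zero_mem
    · exact Submodule.subset_span ⟨⟨n, h⟩, he n⟩
  have hdK : ∀ n, (d n : X) ∈ K := fun n => by
    have h : d n ∈ Submodule.span 𝕜 (Set.range g) := by
      rw [InnerProductSpace.span_gramSchmidtNormed_range, InnerProductSpace.span_gramSchmidt]
      exact Submodule.subset_span ⟨n, rfl⟩
    have h' : Submodule.span 𝕜 (Set.range g) ≤ K.comap R.subtype :=
      Submodule.span_le.2 (by rintro _ ⟨m, rfl⟩; exact hgK m)
    exact h' h
  have hfK : A f ∈ closure (K : Set X) := by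
    have h : (⟨A f, f, rfl⟩ : R) ∈ closure (Set.range d) :=
      (TopologicalSpace.denseRange_denseSeq R) _
    refine map_mem_closure (f := ((↑) : R → X)) continuous_subtype_val h ?_
    rintro _ ⟨n, rfl⟩
    exact hdK n
  -- The family is completed to a Hilbert basis of `X`. The added vectors are orthogonal to the
  -- closure of `K`, which contains `A f`, so they do not contribute to its expansion.
  obtain ⟨w, b, hw, hb⟩ := ho.toSubtypeRange.exists_hilbertBasis_extension
  have hz : ∀ x : w, (x : X) ∉ Set.range (fun i : ι => A (e i)) → inner 𝕜 (x : X) (A f) = 0 := by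
    intro x hx
    have hK : (K : Set X) ⊆ {y | inner 𝕜 (x : X) y = 0} := by
      have : K ≤ LinearMap.ker (innerSL 𝕜 (x : X)).toLinearMap := by
        refine Submodule.span_le.2 ?_
        rintro _ ⟨i, rfl⟩
        have h1 := b.orthonormal.2 (i := x) (j := ⟨A (e i), hw ⟨i, rfl⟩⟩)
          (fun h => hx ⟨i, by rw [h]⟩)
        rw [hb] at h1
        simpa using h1
      intro y hy
      simpa using this hy
    exact closure_minimal hK (isClosed_eq (by fun_prop) continuous_const) hfK
  have hs := b.hasSum_repr (A f)
  simp only [b.repr_apply_apply, hb] at hs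
  let j : ι → w := fun i => ⟨A (e i), hw ⟨i, rfl⟩⟩
  have hj : Function.Injective j := fun i i' h => ho.linearIndependent.injective (congrArg Subtype.val h)
  refine (hj.hasSum_iff ?_).2 hs
  intro x hx
  rw [hz x, zero_smul]
  rintro ⟨i, hi⟩
  exact hx ⟨i, Subtype.ext hi⟩

/-! ### A summability criterion for nuclear maps -/

section Nuclear

variable {𝕜 E F : Type*} [RCLike 𝕜] [AddCommGroup E] [Module 𝕜 E] [TopologicalSpace E]
  [IsTopologicalAddGroup E] [NormedAddCommGroup F] [NormedSpace 𝕜 F] [CompleteSpace F]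

/-- Dividing `φ i` by `a i` and `y i` by `b i` moves all the size into the coefficients `a i * b i`.
Domination by the single continuous seminorm `r` makes the normalized functionals equicontinuous.
The index set is moved into `ℕ` by extension by zero. -/
theorem isNuclearMap_of_summable {ι : Type*} [Countable ι] (T : E →ₗ[𝕜] F) (φ : ι → E →ₗ[𝕜] 𝕜)
    (y : ι → F) (a b : ι → ℝ) (r : Seminorm 𝕜 E) (hr : Continuous r) (ha : ∀ i, 0 ≤ a i)
    (hb : ∀ i, 0 ≤ b i)
    (hφ : ∀ i x, ‖φ i x‖ ≤ a i * r x) (hy : ∀ i, ‖y i‖ ≤ b i)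
    (hab : Summable fun i => a i * b i) (hT : ∀ x, HasSum (fun i => φ i x • y i) (T x)) :
    IsNuclearMap T := by
  classical
  obtain ⟨j, hj⟩ := Countable.exists_injective_nat ι
  have hψ : ∀ i x, ‖((a i : 𝕜)⁻¹ • φ i) x‖ ≤ r x := fun i x => by
    rcases (ha i).eq_or_lt with h | h
    · simp [← h]
    · rw [LinearMap.smul_apply, norm_smul, norm_inv, RCLike.norm_ofReal, abs_of_pos h,
        inv_mul_le_iff₀ h]
      exact hφ i x
  let ψ : ℕ → E →ₗ[𝕜] 𝕜 := Function.extend j (fun i => (a i : 𝕜)⁻¹ • φ i) 0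
  have hψr : ∀ n x, ‖ψ n x‖ ≤ r x := fun n x => by
    by_cases h : ∃ i, j i = n
    · obtain ⟨i, rfl⟩ := h
      simp only [ψ, hj.extend_apply]
      exact hψ i x
    · simp [ψ, Function.extend_apply' _ _ _ h]
  have hcont : Equicontinuous fun n => (ψ n : E → 𝕜) := by
    intro x
    refine Metric.equicontinuousAt_of_continuity_modulus (fun x' => r (x - x')) ?_ _ ?_
    · have : Continuous fun x' => r (x - x') := hr.comp (continuous_const.sub continuous_id)
      simpa using this.tendsto x
    · refine Filter.Eventually.of_forall fun x' n => ?_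
      rw [dist_eq_norm, ← map_sub]
      exact hψr n _
  refine ⟨Function.extend j (fun i => ((a i * b i : ℝ) : 𝕜)) 0,
    fun n => ⟨ψ n, hcont.continuous n⟩, Function.extend j (fun i => (b i : 𝕜)⁻¹ • y i) 0,
    ?_, hcont, ?_, fun x => ?_⟩
  · have h : (fun n => ‖Function.extend j (fun i => ((a i * b i : ℝ) : 𝕜)) 0 n‖) =
        Function.extend j (fun i => a i * b i) 0 := by
      funext n
      by_cases h : ∃ i, j i = n
      · obtain ⟨i, rfl⟩ := h
        rw [hj.extend_apply, hj.extend_apply, RCLike.norm_ofReal,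
          abs_of_nonneg (mul_nonneg (ha i) (hb i))]
      · simp [Function.extend_apply' _ _ _ h]
    rw [h]
    exact (summable_extend_zero hj).2 hab
  · refine isBounded_iff_forall_norm_le.2 ⟨1, ?_⟩
    rintro _ ⟨n, rfl⟩
    by_cases h : ∃ i, j i = n
    · obtain ⟨i, rfl⟩ := h
      rw [hj.extend_apply, norm_smul, norm_inv, RCLike.norm_ofReal, abs_of_nonneg (hb i)]
      exact inv_mul_le_one_of_le₀ (hy i) (hb i)
    · simp [Function.extend_apply' _ _ _ h]
  · convert (hasSum_extend_zero hj).2 (hT x) using 1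
    funext n
    change _ • ψ n x • _ = _
    by_cases h : ∃ i, j i = n
    · obtain ⟨i, rfl⟩ := h
      simp only [ψ, hj.extend_apply, LinearMap.smul_apply, smul_eq_mul, smul_smul]
      -- If `a i` or `b i` is zero, its inverse is the default value `0`, but then `φ i x` or `y i`
      -- vanishes too.
      rcases (ha i).eq_or_lt with h | h
      · have h0 : φ i x = 0 := norm_le_zero_iff.1 ((hφ i x).trans_eq (by simp [← h]))
        simp [h0]
      rcases (hb i).eq_or_lt with h' | h'
      · have h0 : y i = 0 := norm_le_zero_iff.1 ((hy i).trans_eq h'.symm)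
        simp [h0]
      congr 1
      have h1 : (a i : 𝕜) ≠ 0 := RCLike.ofReal_ne_zero.2 h.ne'
      have h2 : (b i : 𝕜) ≠ 0 := RCLike.ofReal_ne_zero.2 h'.ne'
      push_cast
      field_simp
    · simp [Function.extend_apply' _ _ _ h]

end Nuclear

/-! ### Hilbert–Schmidt maps and their composition -/

section HilbertSchmidt

variable {𝕜 E X : Type*} [RCLike 𝕜] [AddCommGroup E] [Module 𝕜 E]
  [NormedAddCommGroup X] [InnerProductSpace 𝕜 X]

/-- The error of a partial sum is the image of one element of `E`, and `T` of that element is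
controlled by `A` of it. Hence an expansion that converges for `A` also converges for `T`. -/
theorem LinearMap.hasSum_of_norm_le {Y ι : Type*} [NormedAddCommGroup Y] [NormedSpace 𝕜 Y]
    (A : E →ₗ[𝕜] X) (T : E →ₗ[𝕜] Y) {C : ℝ} (hT : ∀ f, ‖T f‖ ≤ C * ‖A f‖) {e : ι → E} {c : ι → 𝕜}
    {f : E} (h : HasSum (fun i => c i • A (e i)) (A f)) :
    HasSum (fun i => c i • T (e i)) (T f) := by
  rw [HasSum, tendsto_iff_norm_sub_tendsto_zero] at h ⊢
  refine squeeze_zero (fun _ => norm_nonneg _) (fun s => ?_) (by simpa using h.const_mul C)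
  have := hT (∑ i ∈ s, c i • e i - f)
  simpa using this

/-- `A` is Hilbert–Schmidt with respect to the Hilbert seminorm `‖B ·‖`. -/
def IsHilbertSchmidtWrt (A B : E →ₗ[𝕜] X) : Prop :=
  ∃ S : ℝ, ∀ (ι : Type) (e : ι → E), Orthonormal 𝕜 (fun i => B (e i)) →
    ∀ s : Finset ι, ∑ i ∈ s, ‖A (e i)‖ ^ 2 ≤ S

theorem IsHilbertSchmidtWrt.summable {A B : E →ₗ[𝕜] X} (h : IsHilbertSchmidtWrt A B) {ι : Type}
    {e : ι → E} (he : Orthonormal 𝕜 (fun i => B (e i))) : Summable fun i => ‖A (e i)‖ ^ 2 := by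
  obtain ⟨S, hS⟩ := h
  exact summable_of_sum_le (fun _ => sq_nonneg _) (hS ι e he)

theorem norm_toLocalBanach (q : Seminorm 𝕜 E) (x : E) : ‖toLocalBanach q x‖ = q x :=
  UniformSpace.Completion.norm_coe (E := SeminormedCopy q) x

/-- The canonical map to a local Banach space is nuclear if it factors through two Hilbert–Schmidt
maps. -/
theorem isNuclearMap_toLocalBanach_of_isHilbertSchmidtWrt [CompleteSpace X]
    [SecondCountableTopology X] [TopologicalSpace E] [IsTopologicalAddGroup E]
    {q : Seminorm 𝕜 E} {A₀ A₁ A₂ : E →ₗ[𝕜] X} {C C₁ C₂ : ℝ}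
    (hq : ∀ f, q f ≤ C * ‖A₀ f‖) (h₁ : ∀ f, ‖A₀ f‖ ≤ C₁ * ‖A₁ f‖)
    (h₂ : ∀ f, ‖A₁ f‖ ≤ C₂ * ‖A₂ f‖) (hA₂ : Continuous A₂)
    (h₀₁ : IsHilbertSchmidtWrt A₀ A₁) (h₁₂ : IsHilbertSchmidtWrt A₁ A₂) :
    IsNuclearMap (toLocalBanach q) := by
  obtain ⟨ι, hι, e, he, hes⟩ := A₁.exists_orthonormal_hasSum
  obtain ⟨κ, hκ, g, hg, hgs⟩ := A₂.exists_orthonormal_hasSum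
  wlog hC : 0 ≤ C generalizing C
  · refine this (C := 0) (fun f => (hq f).trans ?_) le_rfl
    exact mul_le_mul_of_nonneg_right (not_le.1 hC).le (norm_nonneg _)
  have hsg := h₁₂.summable hg
  have hle : ∀ i m, ‖inner 𝕜 (A₁ (e i)) (A₁ (g m))‖ ^ 2 ≤ ‖A₁ (g m)‖ ^ 2 := fun i m => by
    gcongr
    simpa [he.1 i] using norm_inner_le_norm (𝕜 := 𝕜) (A₁ (e i)) (A₁ (g m))
  have hsm : ∀ i, Summable fun m => ‖inner 𝕜 (A₁ (e i)) (A₁ (g m))‖ ^ 2 := fun i =>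
    hsg.of_nonneg_of_le (fun _ => sq_nonneg _) (hle i)
  -- `a i` bounds the functional `φ i` below with respect to `‖A₂ ·‖`: its coordinates in the basis
  -- `A₂ (g m)` are the inner products of `A₁ (e i)` and `A₁ (g m)`.
  let a : ι → ℝ := fun i => √(∑' m, ‖inner 𝕜 (A₁ (e i)) (A₁ (g m))‖ ^ 2)
  have hnn : ∀ i, 0 ≤ ∑' m, ‖inner 𝕜 (A₁ (e i)) (A₁ (g m))‖ ^ 2 := fun i =>
    tsum_nonneg fun _ => sq_nonneg _
  have ha : Summable fun i => a i ^ 2 := by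
    refine summable_of_sum_le (c := ∑' m, ‖A₁ (g m)‖ ^ 2) (fun _ => sq_nonneg _) fun s => ?_
    simp only [a, Real.sq_sqrt (hnn _)]
    rw [← Summable.tsum_finsetSum fun i _ => hsm i]
    -- After exchanging the sums, Bessel's inequality for `A₁ (e i)` bounds each term by `‖A₁ (g m)‖
    -- ^ 2`.
    exact (summable_sum fun i _ => hsm i).tsum_le_tsum (fun m => he.sum_inner_products_le _) hsg
  have hb : Summable fun i => q (e i) ^ 2 := by
    refine ((h₀₁.summable he).mul_left (C ^ 2)).of_nonneg_of_le (fun _ => sq_nonneg _) fun i => ?_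
    rw [← mul_pow]
    exact pow_le_pow_left₀ (apply_nonneg _ _) (hq _) 2
  let φ : ι → E →ₗ[𝕜] 𝕜 := fun i => (innerSL 𝕜 (A₁ (e i))).toLinearMap ∘ₗ A₁
  have hφ : ∀ i f, φ i f = inner 𝕜 (A₁ (e i)) (A₁ f) := fun i f => rfl
  refine isNuclearMap_of_summable (toLocalBanach q) φ (fun i => toLocalBanach q (e i)) a
    (fun i => q (e i)) ((normSeminorm 𝕜 X).comp A₂) (continuous_norm.comp hA₂)
    (fun _ => Real.sqrt_nonneg _) (fun _ => apply_nonneg _ _) (fun i f => ?_)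
    (fun i => (norm_toLocalBanach q _).le) ?_ fun f => ?_
  · have hφC : ∀ f, ‖φ i f‖ ≤ C₂ * ‖A₂ f‖ := fun f => by
      refine le_trans ?_ (h₂ f)
      rw [hφ]
      simpa [he.1 i] using norm_inner_le_norm (𝕜 := 𝕜) (A₁ (e i)) (A₁ f)
    -- Expand `A₂ f` along `A₂ (g m)`, then apply Cauchy–Schwarz to the partial sums and Bessel's
    -- inequality to the coordinates of `A₂ f`.
    refine le_of_tendsto (A₂.hasSum_of_norm_le (φ i) hφC (hgs f)).norm
      (Filter.Eventually.of_forall fun s => ?_)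
    calc ‖∑ m ∈ s, inner 𝕜 (A₂ (g m)) (A₂ f) • φ i (g m)‖
        ≤ ∑ m ∈ s, ‖φ i (g m)‖ * ‖inner 𝕜 (A₂ (g m)) (A₂ f)‖ := by
          refine (norm_sum_le _ _).trans_eq (Finset.sum_congr rfl fun m _ => ?_)
          rw [norm_smul, mul_comm]
      _ ≤ √(∑ m ∈ s, ‖φ i (g m)‖ ^ 2) * √(∑ m ∈ s, ‖inner 𝕜 (A₂ (g m)) (A₂ f)‖ ^ 2) :=
          Real.sum_mul_le_sqrt_mul_sqrt _ _ _
      _ ≤ a i * ‖A₂ f‖ := by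
          gcongr
          · exact Real.sqrt_le_sqrt ((hsm i).sum_le_tsum _ fun _ _ => sq_nonneg _)
          · exact Real.sqrt_le_iff.2 ⟨norm_nonneg _, hg.sum_inner_products_le _⟩
  · refine ((ha.add hb).div_const 2).of_nonneg_of_le
      (fun i => mul_nonneg (Real.sqrt_nonneg _) (apply_nonneg _ _)) fun i => ?_
    linarith [two_mul_le_add_sq (a i) (q (e i))]
  · refine A₁.hasSum_of_norm_le (toLocalBanach q) (C := C * C₁) (fun f => ?_) (hes f)
    rw [norm_toLocalBanach, mul_assoc]
    exact (hq f).trans (mul_le_mul_of_nonneg_left (h₁ f) hC)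

end HilbertSchmidt

/-! ### Mean value inequalities for entire functions -/

section MeanValue

variable {k : ℕ}

theorem Circle.measurePreserving_smul_pi (c : Circle) :
    MeasurePreserving (fun w : Fin k → ℂ => (c : ℂ) • w) volume volume := by
  refine volume_preserving_pi (f := fun _ (w : ℂ) => (c : ℂ) • w) fun _ => ?_
  exact (rotation c).measurePreserving

theorem setIntegral_closedBall_circle_smul (f : (Fin k → ℂ) → ℂ) (c : Circle) (r : ℝ) :
    ∫ w in Metric.closedBall 0 r, f ((c : ℂ) • w) = ∫ w in Metric.closedBall 0 r, f w := by
  have hc : (c : ℂ) ≠ 0 := c.coe_ne_zero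
  have h := c.measurePreserving_smul_pi.setIntegral_preimage_emb
    (Homeomorph.smulOfNeZero (c : ℂ) hc).measurableEmbedding f (Metric.closedBall 0 r)
  rw [← h]
  congr 2
  ext w
  rw [Set.mem_preimage, mem_closedBall_zero_iff, mem_closedBall_zero_iff, norm_smul,
    Circle.norm_coe, one_mul]

/-- The mean value property of entire functions on balls of the sup norm. -/
theorem Differentiable.setAverage_closedBall {f : (Fin k → ℂ) → ℂ} (hf : Differentiable ℂ f)
    (z : Fin k → ℂ) {r : ℝ} (hr : 0 < r) :
    ⨍ w in Metric.closedBall 0 r, f (z + w) = f z := by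
  -- One-variable mean value property on the complex line through `z` in the direction `w`. The ball
  -- and its measure are invariant under `w ↦ c • w` with `‖c‖ = 1`, so integrating over both the
  -- angle and `w` yields the result.
  have hcirc : ∀ w : Fin k → ℂ,
      ∫ θ in 0..2 * Real.pi, f (z + circleMap 0 1 θ • w) = (2 * Real.pi : ℝ) • f z := fun w => by
    have hd : Differentiable ℂ fun t : ℂ => f (z + t • w) := hf.comp (by fun_prop)
    have h := (hd.diffContOnCl (s := Metric.ball 0 |1|)).circleAverage
    rw [Real.circleAverage_def, inv_smul_eq_iff₀ (by positivity)] at h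
    simpa using h
  have hrot : ∀ θ : ℝ, ∫ w in Metric.closedBall 0 r, f (z + circleMap 0 1 θ • w) =
      ∫ w in Metric.closedBall 0 r, f (z + w) := fun θ => by
    have h := setIntegral_closedBall_circle_smul (fun w => f (z + w)) (Circle.exp θ) r
    simpa [circleMap] using h
  have hint : Integrable (Function.uncurry fun (θ : ℝ) (w : Fin k → ℂ) =>
      f (z + circleMap 0 1 θ • w)) ((volume.restrict (Set.uIoc 0 (2 * Real.pi))).prod
        (volume.restrict (Metric.closedBall 0 r))) := by
    rw [Measure.prod_restrict]
    have hc : Continuous (Function.uncurry fun (θ : ℝ) (w : Fin k → ℂ) =>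
        f (z + circleMap 0 1 θ • w)) := by
      have := hf.continuous
      have := continuous_circleMap 0 1
      simp only [Function.uncurry_def]
      fun_prop
    exact (hc.continuousOn.integrableOn_compact
      (isCompact_uIcc.prod (isCompact_closedBall 0 r))).mono_set
        (Set.prod_mono Set.uIoc_subset_uIcc subset_rfl)
  have h := intervalIntegral_integral_swap hint
  simp only [hrot, hcirc, intervalIntegral.integral_const, integral_const, sub_zero] at h
  have hv : volume.real (Metric.closedBall (0 : Fin k → ℂ) r) ≠ 0 :=
    (ENNReal.toReal_pos (Metric.measure_closedBall_pos volume 0 hr).ne'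
      measure_closedBall_lt_top.ne).ne'
  rw [measureReal_restrict_apply_univ, smul_comm] at h
  rw [setAverage_eq, inv_smul_eq_iff₀ hv]
  exact smul_right_injective ℂ (by positivity : 2 * Real.pi ≠ 0) h

/-- The mean value property, followed by Jensen's inequality for the convex function `t ↦ t ^ p`. -/
theorem Differentiable.norm_rpow_le_setAverage {f : (Fin k → ℂ) → ℂ} (hf : Differentiable ℂ f)
    (z : Fin k → ℂ) {r p : ℝ} (hr : 0 < r) (hp : 1 ≤ p) :
    ‖f z‖ ^ p ≤ ⨍ w in Metric.closedBall 0 r, ‖f (z + w)‖ ^ p := by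
  have hc : Continuous fun w => f (z + w) := hf.continuous.comp (by fun_prop)
  have hint : ∀ g : (Fin k → ℂ) → ℝ, Continuous g → IntegrableOn g (Metric.closedBall 0 r) :=
    fun g hg => hg.continuousOn.integrableOn_compact (isCompact_closedBall 0 r)
  have hcp : Continuous fun w => ‖f (z + w)‖ ^ p :=
    hc.norm.rpow_const fun _ => Or.inr (by linarith)
  have h1 : ‖f z‖ ≤ ⨍ w in Metric.closedBall 0 r, ‖f (z + w)‖ := by
    rw [← hf.setAverage_closedBall z hr]
    exact norm_integral_le_integral_norm _
  refine (Real.rpow_le_rpow (norm_nonneg _) h1 (by linarith)).trans ?_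
  exact (convexOn_rpow hp).map_set_average_le
    (continuousOn_id.rpow_const fun _ _ => Or.inr (by linarith)) isClosed_Ici
    (Metric.measure_closedBall_pos volume 0 hr).ne' measure_closedBall_lt_top.ne
    (Filter.Eventually.of_forall fun _ => norm_nonneg _) (hint _ hc.norm) (hint _ hcp)

end MeanValue

/-! ### Comparison of the sup and `L^p` seminorms -/

namespace DefiningFamily

variable {Γ : Type*} {k : ℕ} (M : DefiningFamily Γ k)

/-- Local positivity gives finitely many weights covering `K`, and directedness merges them into
one. -/
theorem exists_pos_le_of_isCompact {K : Set (Fin k → ℂ)} (hK : IsCompact K) :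
    ∃ γ, ∃ c : ℝ, 0 < c ∧ ∀ z ∈ K, c ≤ M γ z := by
  refine hK.induction_on (p := fun s => ∃ γ, ∃ c : ℝ, 0 < c ∧ ∀ z ∈ s, c ≤ M γ z) ?_ ?_ ?_ ?_
  · exact ⟨(M.locally_pos 0).choose, 1, one_pos, by simp⟩
  · rintro s t hst ⟨γ, c, hc, h⟩
    exact ⟨γ, c, hc, fun z hz => h z (hst hz)⟩
  · rintro s t ⟨γ₁, c₁, hc₁, h₁⟩ ⟨γ₂, c₂, hc₂, h₂⟩
    obtain ⟨γ, C, hC, h⟩ := M.directed γ₁ γ₂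
    refine ⟨γ, C * min c₁ c₂, by positivity, fun z hz => le_trans ?_ (h z)⟩
    have := M.nonneg γ₁ z
    have := M.nonneg γ₂ z
    refine mul_le_mul_of_nonneg_left ?_ hC.le
    rcases hz with hz | hz
    · linarith [h₁ z hz, min_le_left c₁ c₂]
    · linarith [h₂ z hz, min_le_right c₁ c₂]
  · intro z _
    obtain ⟨γ, U, hU, C, hC, h⟩ := M.locally_pos z
    exact ⟨U, mem_nhdsWithin_of_mem_nhds hU, γ, C, hC, h⟩

variable {M}

/-- The function `L` in condition (I) can be taken bounded. -/
theorem ConditionI.exists_bounded (hI : M.ConditionI) (γ : Γ) :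
    ∃ γ', ∃ L : (Fin k → ℂ) → ℝ, ∃ B : ℝ, (∀ z, 0 ≤ L z) ∧ (∀ z, L z ≤ B) ∧ Integrable L volume ∧
      ∀ z, M γ z ≤ L z * M γ' z := by
  classical
  obtain ⟨γ₁, L, hL0, hL, hM, hlim⟩ := hI γ
  obtain ⟨R, -, hR⟩ := (hasBasis_cobounded_norm.eventually_iff).1
    (hlim.eventually (ge_mem_nhds zero_lt_one))
  obtain ⟨A, hA⟩ := M.bddAbove_of_isBounded γ (Metric.closedBall 0 R) Metric.isBounded_closedBall
  obtain ⟨γ₂, c, hc, hγ₂⟩ := M.exists_pos_le_of_isCompact (isCompact_closedBall (0 : Fin k → ℂ) R)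
  obtain ⟨γ₃, D, hD, hγ₃⟩ := M.directed γ₁ γ₂
  let K := Metric.closedBall (0 : Fin k → ℂ) R
  -- Outside the ball `L ≤ 1`. On it, `L` is replaced by the constant `|A| / c`, since there `M γ ≤
  -- |A|` and `M γ₂ ≥ c`. The factor `D⁻¹` pays for passing from `M γ₁ + M γ₂` to `M γ₃`.
  let L' : (Fin k → ℂ) → ℝ := fun z => D⁻¹ * K.piecewise (fun _ => |A| / c) L z
  refine ⟨γ₃, L', D⁻¹ * max (|A| / c) 1, fun z => ?_, fun z => ?_, ?_, fun z => ?_⟩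
  · by_cases hz : z ∈ K
    · simp only [L', Set.piecewise_eq_of_mem _ _ _ hz]; positivity
    · simp only [L', Set.piecewise_eq_of_notMem _ _ _ hz]
      exact mul_nonneg (by positivity) (hL0 z)
  · refine mul_le_mul_of_nonneg_left ?_ (by positivity)
    by_cases hz : z ∈ K
    · rw [Set.piecewise_eq_of_mem _ _ _ hz]; exact le_max_left _ _
    · rw [Set.piecewise_eq_of_notMem _ _ _ hz]
      refine (hR ?_).trans (le_max_right _ _)
      simp only [K, mem_closedBall_zero_iff, not_le] at hz
      exact hz.le
  · refine Integrable.const_mul (Integrable.piecewise Metric.isClosed_closedBall.measurableSet ?_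
      hL.integrableOn) _
    exact integrableOn_const (hs := measure_closedBall_lt_top.ne)
  · have h₁ := M.nonneg γ₁ z
    have h₂ := M.nonneg γ₂ z
    have h₃ : M γ₁ z + M γ₂ z ≤ D⁻¹ * M γ₃ z := by
      rw [le_inv_mul_iff₀ hD]; exact hγ₃ z
    by_cases hz : z ∈ K
    · simp only [L', Set.piecewise_eq_of_mem _ _ _ hz]
      calc M γ z ≤ |A| := (hA ⟨z, hz, rfl⟩).trans (le_abs_self A)
        _ = |A| / c * c := by field_simp
        _ ≤ |A| / c * (D⁻¹ * M γ₃ z) := by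
          gcongr
          linarith [hγ₂ z hz]
        _ = _ := by ring
    · simp only [L', Set.piecewise_eq_of_notMem _ _ _ hz]
      calc M γ z ≤ L z * M γ₁ z := hM z
        _ ≤ L z * (D⁻¹ * M γ₃ z) := mul_le_mul_of_nonneg_left (by linarith) (hL0 z)
        _ = _ := by ring

/-- Pointwise, `L ^ p ≤ B ^ (p - 1) * L`. -/
theorem _root_.MeasureTheory.Integrable.rpow_of_bounded {α : Type*} [MeasurableSpace α]
    {μ : Measure α} {L : α → ℝ} {B p : ℝ} (hL : Integrable L μ) (h0 : ∀ z, 0 ≤ L z)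
    (hB : ∀ z, L z ≤ B) (hp : 1 ≤ p) : Integrable (fun z => L z ^ p) μ := by
  refine (hL.const_mul (B ^ (p - 1))).mono' (hL.aemeasurable.pow_const p).aestronglyMeasurable
    (Eventually.of_forall fun z => ?_)
  rw [Real.norm_of_nonneg (Real.rpow_nonneg (h0 z) _)]
  rcases (h0 z).eq_or_lt with h | h
  · rw [← h, Real.zero_rpow (by linarith), mul_zero]
  · calc L z ^ p = L z ^ (p - 1) * L z := by
          rw [← Real.rpow_add_one h.ne', sub_add_cancel]
      _ ≤ _ := by
          gcongr
          · exact hB z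

/-- Pointwise `M γ * ‖f‖ ≤ L * b`, so the `L^p` norm of `L` serves as the constant. -/
theorem ConditionI.exists_integral_rpow_le (hI : M.ConditionI) (γ : Γ) {p : ℝ} (hp : 1 ≤ p) :
    ∃ γ', ∃ C : ℝ, 0 ≤ C ∧ ∀ (f : (Fin k → ℂ) → ℂ) (b : ℝ), Differentiable ℂ f →
      (∀ z, M γ' z * ‖f z‖ ≤ b) → Integrable (fun z => M γ z ^ p * ‖f z‖ ^ p) volume ∧
        (∫ z, M γ z ^ p * ‖f z‖ ^ p) ^ (1 / p) ≤ C * b := by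
  obtain ⟨γ', L, B, hL0, hLB, hL, hM⟩ := hI.exists_bounded γ
  have hLp := hL.rpow_of_bounded hL0 hLB hp
  have hp0 : 0 ≤ p := by linarith
  have hi0 : 0 ≤ ∫ z, L z ^ p := integral_nonneg fun z => Real.rpow_nonneg (hL0 z) p
  refine ⟨γ', (∫ z, L z ^ p) ^ (1 / p), Real.rpow_nonneg hi0 _, fun f b hf hb => ?_⟩
  have hb0 : 0 ≤ b := (mul_nonneg (M.nonneg γ' 0) (norm_nonneg (f 0))).trans (hb 0)
  have h0 : ∀ z, 0 ≤ M γ z ^ p * ‖f z‖ ^ p := fun z =>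
    mul_nonneg (Real.rpow_nonneg (M.nonneg γ z) _) (Real.rpow_nonneg (norm_nonneg _) _)
  have hle : ∀ z, M γ z ^ p * ‖f z‖ ^ p ≤ L z ^ p * b ^ p := fun z => by
    rw [← Real.mul_rpow (M.nonneg γ z) (norm_nonneg _), ← Real.mul_rpow (hL0 z) hb0]
    refine Real.rpow_le_rpow (mul_nonneg (M.nonneg γ z) (norm_nonneg _)) ?_ hp0
    calc M γ z * ‖f z‖ ≤ L z * M γ' z * ‖f z‖ :=
          mul_le_mul_of_nonneg_right (hM z) (norm_nonneg _)
      _ = L z * (M γ' z * ‖f z‖) := by ring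
      _ ≤ L z * b := mul_le_mul_of_nonneg_left (hb z) (hL0 z)
  have hint : Integrable (fun z => M γ z ^ p * ‖f z‖ ^ p) volume := by
    refine (hLp.mul_const (b ^ p)).mono' ?_ (Eventually.of_forall fun z => ?_)
    · exact (((M.aemeasurable γ).pow_const p).mul
        (hf.continuous.norm.measurable.pow_const p).aemeasurable).aestronglyMeasurable
    · rw [Real.norm_of_nonneg (h0 z)]
      exact hle z
  refine ⟨hint, ?_⟩
  calc (∫ z, M γ z ^ p * ‖f z‖ ^ p) ^ (1 / p) ≤ (∫ z, L z ^ p * b ^ p) ^ (1 / p) :=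
        Real.rpow_le_rpow (integral_nonneg h0) (integral_mono hint (hLp.mul_const _) hle)
          (by positivity)
    _ = (∫ z, L z ^ p) ^ (1 / p) * b := by
        rw [integral_mul_const, Real.mul_rpow hi0 (Real.rpow_nonneg hb0 _), one_div,
          Real.rpow_rpow_inv hb0 (by linarith)]

/-- Average `‖f‖ ^ p` over a ball lying in the neighborhood from (II), absorb the weight under the
integral, and enlarge the ball to the whole space. The volume `V` of the ball enters the constant
through `V⁻¹ ^ (1 / p)`. -/
theorem ConditionII.exists_mul_norm_le (hII : M.ConditionII) (γ : Γ) {p : ℝ} (hp : 1 ≤ p) :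
    ∃ γ', ∃ C : ℝ, 0 ≤ C ∧ ∀ f : (Fin k → ℂ) → ℂ, Differentiable ℂ f →
      Integrable (fun z => M γ' z ^ p * ‖f z‖ ^ p) volume →
        ∀ z, M γ z * ‖f z‖ ≤ C * (∫ z, M γ' z ^ p * ‖f z‖ ^ p) ^ (1 / p) := by
  obtain ⟨γ', B, hB, C, hC, hM⟩ := hII γ
  obtain ⟨r, hr, hrB⟩ := Metric.nhds_basis_closedBall.mem_iff.1 hB
  let K := Metric.closedBall (0 : Fin k → ℂ) r
  let V := volume.real K
  have hV : 0 ≤ V := measureReal_nonneg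
  have hp0 : 0 < p := by linarith
  refine ⟨γ', C * V⁻¹ ^ (1 / p), by positivity, fun f hf hint z => ?_⟩
  have h0 : ∀ z, 0 ≤ M γ' z ^ p * ‖f z‖ ^ p := fun z =>
    mul_nonneg (Real.rpow_nonneg (M.nonneg γ' z) _) (Real.rpow_nonneg (norm_nonneg _) _)
  have hi0 : 0 ≤ ∫ z, M γ' z ^ p * ‖f z‖ ^ p := integral_nonneg h0
  have hint' : Integrable (fun w => M γ' (z + w) ^ p * ‖f (z + w)‖ ^ p) volume :=
    hint.comp_add_left z
  have hcp : Continuous fun w => ‖f (z + w)‖ ^ p :=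
    (hf.continuous.comp (continuous_const.add continuous_id)).norm.rpow_const
      fun _ => Or.inr hp0.le
  have key : (M γ z * ‖f z‖) ^ p ≤ C ^ p * V⁻¹ * ∫ z, M γ' z ^ p * ‖f z‖ ^ p := by
    calc (M γ z * ‖f z‖) ^ p = M γ z ^ p * ‖f z‖ ^ p :=
          Real.mul_rpow (M.nonneg γ z) (norm_nonneg _)
      _ ≤ M γ z ^ p * (V⁻¹ * ∫ w in K, ‖f (z + w)‖ ^ p) := by
          refine mul_le_mul_of_nonneg_left ?_ (Real.rpow_nonneg (M.nonneg γ z) _)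
          have h := hf.norm_rpow_le_setAverage z hr hp
          rwa [setAverage_eq, smul_eq_mul] at h
      _ = V⁻¹ * ∫ w in K, M γ z ^ p * ‖f (z + w)‖ ^ p := by
          rw [integral_const_mul]; ring
      _ ≤ V⁻¹ * ∫ w in K, C ^ p * (M γ' (z + w) ^ p * ‖f (z + w)‖ ^ p) := by
          refine mul_le_mul_of_nonneg_left ?_ (inv_nonneg.2 hV)
          refine setIntegral_mono_on ?_ (hint'.const_mul _).integrableOn
            Metric.isClosed_closedBall.measurableSet fun w hw => ?_
          · exact (continuous_const.mul hcp).continuousOn.integrableOn_compact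
              (isCompact_closedBall 0 r)
          · rw [← mul_assoc, ← Real.mul_rpow hC.le (M.nonneg γ' _)]
            exact mul_le_mul_of_nonneg_right
              (Real.rpow_le_rpow (M.nonneg γ z) (hM z w (hrB hw)) hp0.le)
              (Real.rpow_nonneg (norm_nonneg _) _)
      _ = C ^ p * V⁻¹ * ∫ w in K, M γ' (z + w) ^ p * ‖f (z + w)‖ ^ p := by
          rw [integral_const_mul]; ring
      _ ≤ C ^ p * V⁻¹ * ∫ w, M γ' (z + w) ^ p * ‖f (z + w)‖ ^ p := by
          gcongr ?_ * ?_
          exact setIntegral_le_integral hint' (Eventually.of_forall fun w => h0 (z + w))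
      _ = C ^ p * V⁻¹ * ∫ z, M γ' z ^ p * ‖f z‖ ^ p := by
          rw [integral_add_left_eq_self (fun z => M γ' z ^ p * ‖f z‖ ^ p) z]
  have h := Real.rpow_le_rpow (Real.rpow_nonneg (mul_nonneg (M.nonneg γ z) (norm_nonneg _)) p) key
    (one_div_nonneg.2 hp0.le)
  simp only [one_div] at h ⊢
  rwa [Real.rpow_rpow_inv (mul_nonneg (M.nonneg γ z) (norm_nonneg _)) hp0.ne',
    Real.mul_rpow (by positivity) hi0, Real.mul_rpow (by positivity) (by positivity),
    Real.rpow_rpow_inv hC.le hp0.ne'] at h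

/-! ### Coincidence of the spaces and of their topologies -/

theorem ConditionI.hSubmodule_le (hI : M.ConditionI) {p : ℝ} (hp : 1 ≤ p) :
    M.HSubmodule ≤ M.HpSubmodule p hp := by
  rintro f ⟨hf, hb⟩
  refine ⟨hf, fun γ => ?_⟩
  obtain ⟨γ', C, -, h⟩ := hI.exists_integral_rpow_le γ hp
  obtain ⟨b, hb⟩ := hb γ'
  exact (h f b hf fun z => hb ⟨z, rfl⟩).1

theorem ConditionII.hpSubmodule_le (hII : M.ConditionII) {p : ℝ} (hp : 1 ≤ p) :
    M.HpSubmodule p hp ≤ M.HSubmodule := by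
  rintro f ⟨hf, hi⟩
  refine ⟨hf, fun γ => ?_⟩
  obtain ⟨γ', C, -, h⟩ := hII.exists_mul_norm_le γ hp
  exact ⟨_, by rintro _ ⟨z, rfl⟩; exact h f hf (hi γ') z⟩

theorem hSubmodule_eq (hI : M.ConditionI) (hII : M.ConditionII) {p : ℝ} (hp : 1 ≤ p) :
    M.HSubmodule = M.HpSubmodule p hp :=
  le_antisymm (hI.hSubmodule_le hp) (hII.hpSubmodule_le hp)

theorem mul_norm_le_hSeminorm (γ : Γ) (f : M.H) (z : Fin k → ℂ) :
    M γ z * ‖f z‖ ≤ M.HSeminorm γ f :=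
  le_ciSup (f.bddAbove γ) z

variable (M) in
theorem withSeminorms_H : WithSeminorms M.HSeminorm := ⟨rfl⟩

variable (M) in
theorem withSeminorms_Hp (p : ℝ) (hp : 1 ≤ p) : WithSeminorms (M.HpSeminorm p hp) := ⟨rfl⟩

instance : IsTopologicalAddGroup M.H := M.withSeminorms_H.topologicalAddGroup

instance : T2Space M.H := by
  have : T1Space M.H := M.withSeminorms_H.T1_of_separating fun f hf => by
    obtain ⟨z, hz⟩ : ∃ z, f z ≠ 0 := by
      by_contra! h
      exact hf (DFunLike.ext f 0 h)
    obtain ⟨γ, U, hU, C, hC, h⟩ := M.locally_pos z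
    refine ⟨γ, (lt_of_lt_of_le ?_ (mul_norm_le_hSeminorm γ f z)).ne'⟩
    exact mul_pos (hC.trans_le (h z (mem_of_mem_nhds hU))) (norm_pos_iff.2 hz)
  infer_instance

theorem exists_continuousLinearEquiv (hI : M.ConditionI) (hII : M.ConditionII) (p : ℝ)
    (hp : 1 ≤ p) : ∃ e : M.H ≃L[ℂ] M.Hp p hp, ∀ (f : M.H) (z : Fin k → ℂ), (e f) z = f z := by
  let e : M.H ≃ₗ[ℂ] M.Hp p hp := LinearEquiv.ofEq _ _ (hSubmodule_eq hI hII hp)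
  have he : ∀ (f : M.H) (z : Fin k → ℂ), (e f) z = f z := fun f z => rfl
  have he' : ∀ (f : M.Hp p hp) (z : Fin k → ℂ), (e.symm f) z = f z := fun f z => rfl
  have hc : Continuous e := by
    refine WithSeminorms.continuous_of_isBounded M.withSeminorms_H (M.withSeminorms_Hp p hp)
      e.toLinearMap fun γ => ?_
    obtain ⟨γ', C, hC, h⟩ := hI.exists_integral_rpow_le γ hp
    refine ⟨{γ'}, ⟨C, hC⟩, fun f => ?_⟩
    rw [Finset.sup_singleton]
    exact (h f _ f.differentiable (mul_norm_le_hSeminorm γ' f)).2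
  have hc' : Continuous e.symm := by
    refine WithSeminorms.continuous_of_isBounded (M.withSeminorms_Hp p hp) M.withSeminorms_H
      e.symm.toLinearMap fun γ => ?_
    obtain ⟨γ', C, hC, h⟩ := hII.exists_mul_norm_le γ hp
    refine ⟨{γ'}, ⟨C, hC⟩, fun f => ?_⟩
    rw [Finset.sup_singleton]
    exact ciSup_le (h f f.differentiable (f.integrable γ'))
  exact ⟨⟨e, hc, hc'⟩, he⟩

/-! ### Hilbert seminorms and nuclearity -/

theorem ConditionI.integrable_sq (hI : M.ConditionI) (γ : Γ) (f : M.H) :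
    Integrable (fun z => M γ z ^ 2 * ‖f z‖ ^ 2) volume := by
  have h : Integrable (fun z => M γ z ^ (2 : ℝ) * ‖f z‖ ^ (2 : ℝ)) volume :=
    (hI.hSubmodule_le one_le_two f.2).2 γ
  simpa using h

theorem ConditionI.memLp_two (hI : M.ConditionI) (γ : Γ) (f : M.H) :
    MemLp (fun z => (M γ z : ℂ) * f z) 2 volume := by
  simpa using (integrable_rpow_iff f.differentiable.continuous γ one_le_two).1
    ((hI.hSubmodule_le one_le_two f.2).2 γ)

/-- The map `f ↦ M_γ f` from `H(M)` to `L²(ℂ^k)`. -/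
noncomputable def ConditionI.toL2 (hI : M.ConditionI) (γ : Γ) :
    M.H →ₗ[ℂ] Lp ℂ 2 (volume : Measure (Fin k → ℂ)) where
  toFun f := (hI.memLp_two γ f).toLp _
  map_add' f g := by
    rw [← MemLp.toLp_add]
    congr 1
    funext z
    simp [H.add_apply, mul_add]
  map_smul' c f := by
    rw [RingHom.id_apply, ← MemLp.toLp_const_smul]
    congr 1
    funext z
    simp [H.smul_apply, mul_left_comm]

theorem ConditionI.norm_toL2 (hI : M.ConditionI) (γ : Γ) (f : M.H) :
    ‖hI.toL2 γ f‖ = (∫ z, M γ z ^ (2 : ℝ) * ‖f z‖ ^ (2 : ℝ)) ^ (1 / 2 : ℝ) := by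
  have h := integral_rpow_eq_eLpNorm M 2 one_le_two γ ⟨f, hI.hSubmodule_le one_le_two f.2⟩
  refine Eq.trans ?_ h.symm
  rw [ENNReal.ofReal_ofNat]
  exact Lp.norm_toLp _ (hI.memLp_two γ f)

theorem ConditionI.norm_toL2_sq (hI : M.ConditionI) (γ : Γ) (f : M.H) :
    ‖hI.toL2 γ f‖ ^ 2 = ∫ z, M γ z ^ 2 * ‖f z‖ ^ 2 := by
  rw [hI.norm_toL2, ← Real.sqrt_eq_rpow, Real.sq_sqrt]
  · simp
  · exact integral_nonneg fun z => by positivity [M.nonneg γ z]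

theorem ConditionI.exists_norm_toL2_le (hI : M.ConditionI) (γ : Γ) :
    ∃ γ', ∃ C : ℝ, 0 ≤ C ∧ ∀ f : M.H, ‖hI.toL2 γ f‖ ≤ C * M.HSeminorm γ' f := by
  obtain ⟨γ', C, hC, h⟩ := hI.exists_integral_rpow_le γ one_le_two
  refine ⟨γ', C, hC, fun f => ?_⟩
  rw [hI.norm_toL2]
  exact (h f _ f.differentiable (mul_norm_le_hSeminorm γ' f)).2

theorem ConditionI.continuous_toL2 (hI : M.ConditionI) (γ : Γ) : Continuous (hI.toL2 γ) := by
  obtain ⟨γ', C, hC, h⟩ := hI.exists_norm_toL2_le γ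
  refine WithSeminorms.continuous_of_isBounded M.withSeminorms_H (norm_withSeminorms ℂ _) _
    fun _ => ⟨{γ'}, ⟨C, hC⟩, fun f => ?_⟩
  rw [Finset.sup_singleton]
  exact h f

theorem exists_mul_norm_le_norm_toL2 (hI : M.ConditionI) (hII : M.ConditionII) (γ : Γ) :
    ∃ γ', ∃ C : ℝ, 0 ≤ C ∧ ∀ (f : M.H) z, M γ z * ‖f z‖ ≤ C * ‖hI.toL2 γ' f‖ := by
  obtain ⟨γ', C, hC, h⟩ := hII.exists_mul_norm_le γ one_le_two
  refine ⟨γ', C, hC, fun f z => ?_⟩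
  rw [hI.norm_toL2]
  exact h f f.differentiable ((hI.hSubmodule_le one_le_two f.2).2 γ') z

variable (M) in
/-- Evaluation at a point, as a linear functional on `H(M)`. -/
def evalH (z : Fin k → ℂ) : M.H →ₗ[ℂ] ℂ where
  toFun f := f z
  map_add' f g := H.add_apply f g z
  map_smul' c f := H.smul_apply c f z

/-- A bound for the diagonal of the reproducing kernel. -/
theorem _root_.Orthonormal.sum_sq_le_of_norm_le {𝕜 E X ι : Type*} [RCLike 𝕜] [AddCommGroup E]
    [Module 𝕜 E] [NormedAddCommGroup X] [InnerProductSpace 𝕜 X] {A : E →ₗ[𝕜] X} {e : ι → E}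
    (he : Orthonormal 𝕜 (fun i => A (e i))) (φ : E →ₗ[𝕜] 𝕜) {m C : ℝ}
    (h : ∀ f, m * ‖φ f‖ ≤ C * ‖A f‖) (hm : 0 ≤ m) (s : Finset ι) :
    m ^ 2 * ∑ i ∈ s, ‖φ (e i)‖ ^ 2 ≤ C ^ 2 := by
  set S := ∑ i ∈ s, ‖φ (e i)‖ ^ 2 with hS
  have hS0 : 0 ≤ S := Finset.sum_nonneg fun _ _ => sq_nonneg _
  rcases hS0.eq_or_lt with h0 | h0
  · rw [← h0, mul_zero]; positivity
  -- The bound is tested on the extremal combination, for which both `φ` and the squared norm of `A`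
  -- equal `S`.
  have h1 : φ (∑ i ∈ s, (starRingEnd 𝕜) (φ (e i)) • e i) = (S : 𝕜) := by
    simp [hS, RCLike.conj_mul]
  have h2 : ‖A (∑ i ∈ s, (starRingEnd 𝕜) (φ (e i)) • e i)‖ ^ 2 = S := by
    rw [← RCLike.ofReal_inj (K := 𝕜)]
    push_cast
    rw [← inner_self_eq_norm_sq_to_K, map_sum]
    simp only [map_smul]
    rw [he.inner_sum]
    simp [hS, RCLike.mul_conj]
  have h3 := h (∑ i ∈ s, (starRingEnd 𝕜) (φ (e i)) • e i)
  rw [h1, RCLike.norm_ofReal, abs_of_pos h0] at h3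
  have h4 := pow_le_pow_left₀ (by positivity) h3 2
  rw [mul_pow, mul_pow, h2] at h4
  refine le_of_mul_le_mul_right ?_ h0
  calc m ^ 2 * S * S = m ^ 2 * S ^ 2 := by ring
    _ ≤ _ := h4

/-- Evaluation at `z`, weighted by `M γ₁ z`, is bounded by `C` in the seminorm of `γ₂`, uniformly in
`z`. This bounds the diagonal of the reproducing kernel, and `M γ ≤ L * M γ₁` with `L` square
integrable makes its integral finite. -/
theorem exists_isHilbertSchmidtWrt_toL2 (hI : M.ConditionI) (hII : M.ConditionII) (γ : Γ) :
    ∃ γ', ∃ C : ℝ, (∀ f, ‖hI.toL2 γ f‖ ≤ C * ‖hI.toL2 γ' f‖) ∧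
      IsHilbertSchmidtWrt (hI.toL2 γ) (hI.toL2 γ') := by
  obtain ⟨γ₁, L, B, hL0, hLB, hL, hM⟩ := hI.exists_bounded γ
  obtain ⟨γ₂, C, hC, h⟩ := exists_mul_norm_le_norm_toL2 hI hII γ₁
  have hL2 : Integrable (fun z => L z ^ 2) volume := by
    simpa using hL.rpow_of_bounded hL0 hLB one_le_two
  have hsum : ∀ (ι : Type) (s : Finset ι) (e : ι → M.H) (D : ℝ),
      (∀ z, M γ₁ z ^ 2 * ∑ i ∈ s, ‖e i z‖ ^ 2 ≤ D) →
      ∑ i ∈ s, ‖hI.toL2 γ (e i)‖ ^ 2 ≤ (∫ z, L z ^ 2) * D := by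
    intro ι s e D hD
    simp only [hI.norm_toL2_sq]
    rw [← integral_finsetSum _ fun i _ => hI.integrable_sq γ (e i), ← integral_mul_const]
    refine integral_mono (integrable_finsetSum _ fun i _ => hI.integrable_sq γ (e i))
      (hL2.mul_const _) fun z => ?_
    calc ∑ i ∈ s, M γ z ^ 2 * ‖e i z‖ ^ 2 = M γ z ^ 2 * ∑ i ∈ s, ‖e i z‖ ^ 2 := by
          rw [Finset.mul_sum]
      _ ≤ (L z * M γ₁ z) ^ 2 * ∑ i ∈ s, ‖e i z‖ ^ 2 := by
          refine mul_le_mul_of_nonneg_right ?_ (Finset.sum_nonneg fun _ _ => sq_nonneg _)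
          exact pow_le_pow_left₀ (M.nonneg γ z) (hM z) 2
      _ = L z ^ 2 * (M γ₁ z ^ 2 * ∑ i ∈ s, ‖e i z‖ ^ 2) := by ring
      _ ≤ L z ^ 2 * D := mul_le_mul_of_nonneg_left (hD z) (sq_nonneg _)
  refine ⟨γ₂, √(∫ z, L z ^ 2) * C, fun f => ?_, (∫ z, L z ^ 2) * C ^ 2, fun ι e he s => ?_⟩
  -- The norm comparison is the same estimate for the one-element family `f`.
  · have h1 := hsum Unit {()} (fun _ => f) ((C * ‖hI.toL2 γ₂ f‖) ^ 2) fun z => by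
      rw [Finset.sum_singleton, ← mul_pow]
      exact pow_le_pow_left₀ (mul_nonneg (M.nonneg γ₁ z) (norm_nonneg _)) (h f z) 2
    rw [Finset.sum_singleton] at h1
    have h2 := Real.abs_le_sqrt h1
    rwa [abs_norm, Real.sqrt_mul (integral_nonneg fun _ => sq_nonneg _),
      Real.sqrt_sq (by positivity), ← mul_assoc] at h2
  · exact hsum ι s e _ fun z =>
      he.sum_sq_le_of_norm_le (M.evalH z) (fun f => h f z) (M.nonneg γ₁ z) s

/-- Continuity gives a bound by a finite supremum of seminorms; directedness of the weights reduces
it to a single one. -/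
theorem exists_le_hSeminorm_of_continuous (q : Seminorm ℂ M.H) (hq : Continuous q) :
    ∃ γ, ∃ C : ℝ, 0 ≤ C ∧ ∀ f, q f ≤ C * M.HSeminorm γ f := by
  classical
  obtain ⟨s, C, -, h⟩ := Seminorm.bound_of_continuous M.withSeminorms_H q hq
  have hs : ∃ γ, ∃ D : ℝ, 0 ≤ D ∧ ∀ f, s.sup M.HSeminorm f ≤ D * M.HSeminorm γ f := by
    clear h
    induction s using Finset.induction_on with
    | empty => exact ⟨(M.locally_pos 0).choose, 0, le_rfl, fun f => by simp⟩
    | insert γ₁ s _ ih =>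
      obtain ⟨γ₂, D, hD, h₂⟩ := ih
      obtain ⟨γ, A, hA, hγ⟩ := M.directed γ₁ γ₂
      have hle : ∀ f, M.HSeminorm γ₁ f ≤ A⁻¹ * M.HSeminorm γ f ∧
          M.HSeminorm γ₂ f ≤ A⁻¹ * M.HSeminorm γ f := fun f => by
        constructor <;> refine ciSup_le fun z => ?_ <;>
        · rw [le_inv_mul_iff₀ hA]
          refine le_trans ?_ (mul_norm_le_hSeminorm γ f z)
          rw [← mul_assoc]
          refine mul_le_mul_of_nonneg_right (le_trans ?_ (hγ z)) (norm_nonneg _)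
          have := M.nonneg γ₁ z
          have := M.nonneg γ₂ z
          exact mul_le_mul_of_nonneg_left (by linarith) hA.le
      refine ⟨γ, max A⁻¹ (D * A⁻¹), by positivity, fun f => ?_⟩
      rw [Finset.sup_insert, Seminorm.sup_apply]
      have h0 : 0 ≤ M.HSeminorm γ f := apply_nonneg _ _
      refine sup_le ((hle f).1.trans ?_) ((h₂ f).trans ?_)
      · gcongr; exact le_max_left _ _
      · refine (mul_le_mul_of_nonneg_left (hle f).2 hD).trans ?_
        rw [← mul_assoc]
        gcongr; exact le_max_right _ _
  obtain ⟨γ, D, hD, hs⟩ := hs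
  refine ⟨γ, C * D, by positivity, fun f => (h f).trans ?_⟩
  rw [mul_assoc]
  exact mul_le_mul_of_nonneg_left (hs f) C.2

theorem isNuclearSpace_H (hI : M.ConditionI) (hII : M.ConditionII) : IsNuclearSpace ℂ M.H where
  t2Space := inferInstance
  polynormableSpace := M.withSeminorms_H.toPolynormableSpace
  isNuclearMap_toLocalBanach q hq := by
    obtain ⟨γ, C, hC, hqγ⟩ := exists_le_hSeminorm_of_continuous q hq
    obtain ⟨γ₀, C₀, -, h₀⟩ := exists_mul_norm_le_norm_toL2 hI hII γ
    obtain ⟨γ₁, C₁, h₁, hs₁⟩ := exists_isHilbertSchmidtWrt_toL2 hI hII γ₀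
    obtain ⟨γ₂, C₂, h₂, hs₂⟩ := exists_isHilbertSchmidtWrt_toL2 hI hII γ₁
    -- Needed for the instance that `L²` is second countable.
    have : Fact ((2 : ℝ≥0∞) ≠ ∞) := ⟨by simp⟩
    refine isNuclearMap_toLocalBanach_of_isHilbertSchmidtWrt (C := C * C₀) (fun f => ?_) h₁ h₂
      (hI.continuous_toL2 γ₂) hs₁ hs₂
    rw [mul_assoc]
    exact (hqγ f).trans (mul_le_mul_of_nonneg_left (ciSup_le (h₀ f)) hC)

end DefiningFamily

theorem lemma6 {Γ : Type*} {k : ℕ} (M : DefiningFamily Γ k)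
    (hI : M.ConditionI) (hII : M.ConditionII) :
    IsNuclearSpace ℂ M.H ∧
    ∀ (p : ℝ) (hp : 1 ≤ p),
      M.HSubmodule = M.HpSubmodule p hp ∧
      ∃ e : M.H ≃L[ℂ] M.Hp p hp, ∀ (f : M.H) (z : Fin k → ℂ), (e f) z = f z :=
  ⟨DefiningFamily.isNuclearSpace_H hI hII, fun p hp =>
    ⟨DefiningFamily.hSubmodule_eq hI hII hp,
      DefiningFamily.exists_continuousLinearEquiv hI hII p hp⟩⟩
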